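/- Let $\mathbb{R}^{3,1}$ be $\mathbb{R}^4$ with the metric $\langle\cdot,\cdot\rangle=dx_1^2+dx_2^2+dx_3^2-dx_4^2$, and let $M$ be a smooth spacelike surface immersed in $\mathbb{R}^{3,1}$, with second fundamental form $B(X,Y)=\overline\nabla_XY-\nabla_XY$, where $\overline\nabla$ and $\nabla$ are the Levi-Civita connections of $\mathbb{R}^{3,1}$ and of $M$. Let $Z$ be a constant vector of $\mathbb{R}^{3,1}$ with $\langle Z,Z\rangle=1$, decomposed along $M$ into its tangential and normal parts $Z=Z^\top+Z^\perp$, and suppose that $Z$ is a canonical normal null direction on $M$, that is, $Z^\perp$ is lightlike (nonzero and null) at every point of $M$. Let $W$ be a smooth unit tangent vector field on $M$ orthogonal to $Z^\top$, put $a=\langle B(W,W),Z^\perp\rangle$, and let $\beta$ be the 1-form on $M$ determined by $B(X,Z^\top)=\beta(X)Z^\perp$ for all $X\in TM$. If $a=0$ and $\beta(Z^\top)=0$ on $M$, then $M$ is a ruled surface, and around each of its points it can be parametrized by $$\psi(x,y)=\alpha(y)+x\,Z^\top(y),$$ where $\alpha$ is a smooth curve lying on $M$ and $Z^\top(y)$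 denotes the restriction of $Z^\top$ to $\alpha$. More precisely, for each $p\in M$ there are $\varepsilon>0$ and a diffeomorphism $\Phi$ of $(-\varepsilon,\varepsilon)^2$ onto an open neighbourhood of $p=\Phi(0,0)$ in $M$ such that, $\psi$ being $\Phi$ followed by the immersion, the formula holds with $\alpha(y)=\psi(0,y)$ and $Z^\top(y)=Z^\top(\Phi(0,y))$. -/

import Mathlib

open scoped Manifold ContDiff

noncomputable section

namespace MinkowskiSurface

/-- The vector space `ℝ⁴` underlying the Minkowski space `ℝ^{3,1}`; the product topology and
normed structure are only used to speak of smooth maps. -/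
abbrev R31 : Type := Fin 4 → ℝ

/-- The Minkowski product `dx₁² + dx₂² + dx₃² - dx₄²`. -/
def mink (u v : R31) : ℝ := u 0 * v 0 + u 1 * v 1 + u 2 * v 2 - u 3 * v 3

/-- A vector is lightlike when it is nonzero and null. -/
def IsLightlike (v : R31) : Prop := v ≠ 0 ∧ mink v v = 0

/-- The model space `ℝ²` of a surface. -/
abbrev R2 : Type := EuclideanSpace ℝ (Fin 2)

section Surface

variable {M : Type*} [TopologicalSpace M] [ChartedSpace R2 M]

/-- The differential of `F : M → ℝ^{3,1}` at `p`, with values in `ℝ^{3,1}`. -/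
def dF (F : M → R31) (p : M) : TangentSpace (𝓡 2) p →L[ℝ] R31 :=
  mfderiv (𝓡 2) 𝓘(ℝ, R31) F p

/-- `F : M → ℝ^{3,1}` is a smooth immersion inducing a Riemannian metric on `M`
(positive definiteness forces `dF` to be injective). -/
structure IsSpacelikeSurface (F : M → R31) : Prop where
  smooth : ContMDiff (𝓡 2) 𝓘(ℝ, R31) ∞ F
  pos : ∀ (p : M) (u : TangentSpace (𝓡 2) p), u ≠ 0 → 0 < mink (dF F p u) (dF F p u)

open Classical in
/-- The tangent vector `u ∈ T_pM` such that `dF(u)` is the tangential part of `z ∈ ℝ^{3,1}`,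
that is, `z - dF(u)` is orthogonal to `dF(T_pM)`. On a spacelike surface there is exactly one
such `u`. -/
def tangentialPart (F : M → R31) (p : M) (z : R31) : TangentSpace (𝓡 2) p :=
  if h : ∃ u : TangentSpace (𝓡 2) p,
      ∀ w : TangentSpace (𝓡 2) p, mink (z - dF F p u) (dF F p w) = 0
  then h.choose else 0

/-- The normal part of a vector `z` of `ℝ^{3,1}` at `p`. -/
def normalPart (F : M → R31) (p : M) (z : R31) : R31 :=
  z - dF F p (tangentialPart F p z)

theorem exists_tangentialPart {F : M → R31} (hF : IsSpacelikeSurface F) (p : M) (z : R31) :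
    ∃ u : TangentSpace (𝓡 2) p,
      ∀ w : TangentSpace (𝓡 2) p, mink (z - dF F p u) (dF F p w) = 0 := by
  let L : R2 →L[ℝ] R31 := dF F p
  suffices h : ∃ u : R2, ∀ w : R2, mink (z - L u) (L w) = 0 from h
  have hpos : ∀ u : R2, u ≠ 0 → 0 < mink (L u) (L u) := hF.pos p
  let g : R2 →ₗ[ℝ] (R2 →ₗ[ℝ] ℝ) :=
    LinearMap.mk₂ ℝ (fun u w : R2 => mink (L u) (L w))
      (fun a b c => by simp only [mink, map_add, Pi.add_apply]; ring)
      (fun a b c => by simp only [mink, map_smul, Pi.smul_apply, smul_eq_mul]; ring)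
      (fun a b c => by simp only [mink, map_add, Pi.add_apply]; ring)
      (fun a b c => by simp only [mink, map_smul, Pi.smul_apply, smul_eq_mul]; ring)
  have hg : Function.Injective g := by
    rw [injective_iff_map_eq_zero]
    intro u hu
    by_contra hne
    have h1 := hpos u hne
    have h2 : mink (L u) (L u) = 0 := LinearMap.congr_fun hu u
    linarith
  have hs : Function.Surjective g :=
    (LinearMap.injective_iff_surjective_of_finrank_eq_finrank
      (Subspace.dual_finrank_eq (K := ℝ) (V := R2)).symm).1 hg
  let l : R2 →ₗ[ℝ] ℝ :=
    { toFun := fun w => mink z (L w)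
      map_add' := fun a b => by simp only [mink, map_add, Pi.add_apply]; ring
      map_smul' := fun a b => by
        simp only [mink, map_smul, Pi.smul_apply, smul_eq_mul, RingHom.id_apply]; ring }
  obtain ⟨u, hu⟩ := hs l
  refine ⟨u, fun w => ?_⟩
  have h : mink (L u) (L w) = mink z (L w) := LinearMap.congr_fun hu w
  have h' : mink (z - L u) (L w) = mink z (L w) - mink (L u) (L w) := by
    simp only [mink, Pi.sub_apply]; ring
  rw [h', h, sub_self]

/-- The defining property of the normal part: it is orthogonal to the tangent plane. -/
theorem mink_normalPart {F : M → R31} (hF : IsSpacelikeSurface F) (p : M) (z : R31)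
    (w : TangentSpace (𝓡 2) p) : mink (normalPart F p z) (dF F p w) = 0 := by
  have h := exists_tangentialPart hF p z
  unfold normalPart tangentialPart
  rw [dif_pos h]
  exact h.choose_spec w

/-- The tangential part `Z^⊤` of the parallel (that is, constant) vector field `Z`,
a tangent vector field on `M`. -/
def Ztop (F : M → R31) (Z : R31) (p : M) : TangentSpace (𝓡 2) p := tangentialPart F p Z

/-- The normal part `Z^⊥` of the parallel vector field `Z`. -/
def Zperp (F : M → R31) (Z : R31) (p : M) : R31 := normalPart F p Z

/-- `Z` is a canonical normal null direction: `Z^⊥` is a lightlike normal vector field. -/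
def IsCanonicalNormalNullDirection (F : M → R31) (Z : R31) : Prop :=
  ∀ p : M, IsLightlike (Zperp F Z p)

/-- The Levi-Civita connection of the flat space `ℝ^{3,1}` along `M`: the derivative in the
direction `v ∈ T_pM` of the tangent field `Y`, seen as the map `q ↦ dF(Y q)` to `ℝ^{3,1}`. -/
def ambientDeriv (F : M → R31) (p : M) (v : TangentSpace (𝓡 2) p)
    (Y : (q : M) → TangentSpace (𝓡 2) q) : R31 :=
  mfderiv (𝓡 2) 𝓘(ℝ, R31) (fun q : M => dF F q (Y q)) p v

/-- The Levi-Civita connection `∇_v Y` of the induced metric, that is, the tangential part of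
the ambient derivative. -/
def leviCivita (F : M → R31) (p : M) (v : TangentSpace (𝓡 2) p)
    (Y : (q : M) → TangentSpace (𝓡 2) q) : TangentSpace (𝓡 2) p :=
  tangentialPart F p (ambientDeriv F p v Y)

/-- The second fundamental form `B(v, Y)`: ambient derivative minus Levi-Civita derivative. -/
def secondFF (F : M → R31) (p : M) (v : TangentSpace (𝓡 2) p)
    (Y : (q : M) → TangentSpace (𝓡 2) q) : R31 :=
  ambientDeriv F p v Y - dF F p (leviCivita F p v Y)

/-- `W` is a smooth unit tangent vector field on `M` orthogonal to `Z^⊤`. -/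
structure IsUnitOrthogonalField [IsManifold (𝓡 2) ∞ M] (F : M → R31) (Z : R31)
    (W : (q : M) → TangentSpace (𝓡 2) q) : Prop where
  smooth : ContMDiff (𝓡 2) (𝓡 2).tangent ∞ (fun q : M => (⟨q, W q⟩ : TangentBundle (𝓡 2) M))
  unit : ∀ q, mink (dF F q (W q)) (dF F q (W q)) = 1
  orthogonal : ∀ q, mink (dF F q (Ztop F Z q)) (dF F q (W q)) = 0

/-- The 1-form `α(v) = ⟨B(v, W), Z^⊥⟩`. -/
def alphaForm (F : M → R31) (Z : R31) (W : (q : M) → TangentSpace (𝓡 2) q) (p : M)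
    (v : TangentSpace (𝓡 2) p) : ℝ :=
  mink (secondFF F p v W) (Zperp F Z p)

/-- The function `a = α(W)`. -/
def aFun (F : M → R31) (Z : R31) (W : (q : M) → TangentSpace (𝓡 2) q) (p : M) : ℝ :=
  alphaForm F Z W p (W p)

open Classical in
/-- The 1-form `β` with `B(v, Z^⊤) = β(v) Z^⊥`. When `Z` is a unit spacelike canonical normal null
direction on a spacelike surface, `B(v, Z^⊤)` is always a multiple of `Z^⊥`, which is nonzero, so
that `β(v)` exists and is unique. -/
def betaForm (F : M → R31) (Z : R31) (p : M) (v : TangentSpace (𝓡 2) p) : ℝ :=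
  if h : ∃ c : ℝ, secondFF F p v (Ztop F Z) = c • Zperp F Z p then h.choose else 0

/-- `Φ` is a local parametrization of `M` (a diffeomorphism of the square
`(-ε, ε) × (-ε, ε)` onto an open subset of `M`) in which the immersion `F` reads
`(x, y) ↦ α(y) + x w(y)`, with smooth curves `α` and `w` in `ℝ^{3,1}`. -/
structure IsRuledParametrization (F : M → R31) (ε : ℝ) (Φ : OpenPartialHomeomorph (ℝ × ℝ) M)
    (α w : ℝ → R31) : Prop where
  source_eq : Φ.source = Set.Ioo (-ε) ε ×ˢ Set.Ioo (-ε) ε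
  smooth : ContMDiffOn 𝓘(ℝ, ℝ × ℝ) (𝓡 2) ∞ Φ Φ.source
  smooth_symm : ContMDiffOn (𝓡 2) 𝓘(ℝ, ℝ × ℝ) ∞ Φ.symm Φ.target
  smooth_base : ContDiffOn ℝ ∞ α (Set.Ioo (-ε) ε)
  smooth_director : ContDiffOn ℝ ∞ w (Set.Ioo (-ε) ε)
  eq : ∀ x ∈ Set.Ioo (-ε) ε, ∀ y ∈ Set.Ioo (-ε) ε, F (Φ (x, y)) = α y + x • w y

/-- The immersed surface is ruled: around each point it has a parametrization by line segments
`(x, y) ↦ α(y) + x w(y)`. -/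
def IsRuled (F : M → R31) : Prop :=
  ∀ p : M, ∃ ε > 0, ∃ (Φ : OpenPartialHomeomorph (ℝ × ℝ) M) (α w : ℝ → R31),
    p ∈ Φ.target ∧ IsRuledParametrization F ε Φ α w

end Surface

end MinkowskiSurface

end

/-! Write `Z = T + N` along `M`, with `T = dF(Z^⊤)` and `N = Z^⊥` null and normal. Since `Z` is
constant, `dN = -dT`. Differentiating `⟨N, N⟩ = 0` shows that `dT` takes values orthogonal to `N`.
Differentiating `⟨N, dF w⟩ = 0` along `Z^⊤`, and using the symmetry of second derivatives, shows
that the derivative of `T` along `Z^⊤` is normal (`mink_fderiv_tangential`). That derivative is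
therefore `B(Z^⊤, Z^⊤) = β(Z^⊤) N = 0`: as a map to `ℝ^{3,1}`, `T` is constant along itself.

The integral curves of `Z^⊤` are then straight segments with direction `T`, so no flow has to be
constructed. In a chart given by a linear projection `P` (`exists_projection_chart`) the field reads
`P ∘ T`, and the parametrization is explicit: leave a transversal line in the direction `P ∘ T`. The
inverse function theorem makes it a diffeomorphism (`exists_ruled_reparametrization`), and a
Grönwall argument identifies its image lines (`eq_add_smul_of_fderiv_self_eq_zero`). -/

noncomputable section

namespace MinkowskiSurface

/-! ### Inverse function theorem and self-parallel fields. -/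

section Calculus

variable {E V : Type*} [NormedAddCommGroup E] [NormedSpace ℝ E]
  [NormedAddCommGroup V] [NormedSpace ℝ V]

/-- The inverse function theorem, with smoothness of both directions on the whole domain. -/
theorem exists_openPartialHomeomorph_of_hasFDerivAt [CompleteSpace E] {f : E → V} {O : Set E}
    (hO : IsOpen O) (hf : ContDiffOn ℝ ∞ f O) {a : E} (ha : a ∈ O) {f' : E ≃L[ℝ] V}
    (hf' : HasFDerivAt f (f' : E →L[ℝ] V) a) :
    ∃ e : OpenPartialHomeomorph E V, a ∈ e.source ∧ e.source ⊆ O ∧ (∀ x, e x = f x) ∧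
      ContDiffOn ℝ ∞ e.symm e.target := by
  have hfa : ContDiffAt ℝ ∞ f a := hf.contDiffAt (hO.mem_nhds ha)
  let e₀ := hfa.toOpenPartialHomeomorph f hf' (by simp)
  -- Restricting to the open set where the derivative is invertible makes the inverse smooth on all
  -- of the target, not only at the image of `a`.
  let I : Set E := fderiv ℝ f ⁻¹' Set.range ((↑) : (E ≃L[ℝ] V) → E →L[ℝ] V)
  have hcont : ContinuousOn (fderiv ℝ f) O := hf.continuousOn_fderiv_of_isOpen hO (by simp)
  have hI : IsOpen (O ∩ I) := hcont.isOpen_inter_preimage hO ContinuousLinearEquiv.isOpen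
  refine ⟨e₀.restr (O ∩ I), ?_, ?_, fun x => rfl, ?_⟩
  · rw [e₀.restr_source' _ hI]
    exact ⟨hfa.mem_toOpenPartialHomeomorph_source hf' (by simp), ha, f', hf'.fderiv.symm⟩
  · rw [e₀.restr_source' _ hI]
    exact fun x hx => hx.2.1
  · intro y hy
    have hx := (e₀.restr (O ∩ I)).map_target hy
    rw [e₀.restr_source' _ hI] at hx
    obtain ⟨A, hA⟩ := hx.2.2
    have hs : ContDiffAt ℝ ∞ f (e₀.symm y) := hf.contDiffAt (hO.mem_nhds hx.2.1)
    refine ContDiffAt.contDiffWithinAt ?_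
    refine (e₀.restr (O ∩ I)).contDiffAt_symm hy (f₀' := A) ?_ hs
    rw [hA]
    exact (hs.differentiableAt (by simp)).hasFDerivAt

/-- A direction field which is constant along itself integrates to straight segments. -/
theorem eq_add_smul_of_fderiv_self_eq_zero {S T : E → V} {U : Set E} (hU : IsOpen U)
    (hS : ContDiffOn ℝ ∞ S U) (hT : ContDiffOn ℝ ∞ T U) (P : V →L[ℝ] E)
    (hdS : ∀ q ∈ U, fderiv ℝ S q (P (T q)) = T q)
    (hdT : ∀ q ∈ U, fderiv ℝ T q (P (T q)) = 0) {q : E} {x : ℝ}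
    (hseg : ∀ s ∈ Set.Icc (0 : ℝ) 1, q + s • x • P (T q) ∈ U) :
    S (q + x • P (T q)) = S q + x • T q := by
  set v : E := x • P (T q) with hv
  have hline : ∀ s : ℝ, HasDerivAt (fun s : ℝ => q + s • v) v s := fun s => by
    simpa using ((hasDerivAt_id s).smul_const v).const_add q
  have hder : ∀ {f : E → V}, ContDiffOn ℝ ∞ f U → ∀ s ∈ Set.Icc (0 : ℝ) 1,
      HasDerivAt (fun s : ℝ => f (q + s • v)) (fderiv ℝ f (q + s • v) v) s := by
    intro f hf s hs
    have h1 := ((hf.contDiffAt (hU.mem_nhds (hseg s hs))).differentiableAt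
      (by simp)).hasFDerivAt
    exact h1.comp_hasDerivAt s (hline s)
  have hcT : ContinuousOn (fun s : ℝ => fderiv ℝ T (q + s • v)) (Set.Icc 0 1) :=
    (hT.continuousOn_fderiv_of_isOpen hU (by simp)).comp (by fun_prop) hseg
  obtain ⟨K, hK⟩ := isCompact_Icc.exists_bound_of_continuousOn hcT
  -- The segment has the frozen direction `x • P (T q)`, whereas `T` is known to be constant only in
  -- its current direction. The two differ by a term linear in `T (q + s • v) - T q`, so Grönwall
  -- forces this difference to vanish.
  have hconst : ∀ s ∈ Set.Icc (0 : ℝ) 1, T (q + s • v) - T q = 0 := by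
    refine eq_zero_of_abs_deriv_le_mul_abs_self_of_eq_zero_right
      (f := fun s : ℝ => T (q + s • v) - T q)
      (f' := fun s => fderiv ℝ T (q + s • v) v) (K := K * (|x| * ‖P‖))
      (fun s hs => ((hder hT s hs).continuousAt.sub continuousAt_const).continuousWithinAt)
      (fun s hs => ((hder hT s ⟨hs.1, hs.2.le⟩).sub_const _).hasDerivWithinAt) (by simp) ?_
    intro s hs
    have hs' : s ∈ Set.Icc (0 : ℝ) 1 := ⟨hs.1, hs.2.le⟩
    have h0 := hdT _ (hseg s hs')
    have h1 : fderiv ℝ T (q + s • v) v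
        = -(fderiv ℝ T (q + s • v) (x • P (T (q + s • v) - T q))) := by
      simp only [map_sub, map_smul, smul_sub, h0, smul_zero, zero_sub, neg_neg]
      rw [← map_smul]
    rw [h1, norm_neg]
    refine (ContinuousLinearMap.le_opNorm _ _).trans ?_
    rw [norm_smul, Real.norm_eq_abs, mul_assoc K, mul_assoc]
    have h2 := hK s hs'
    have h3 := P.le_opNorm (T (q + s • v) - T q)
    have := (norm_nonneg _).trans h2
    gcongr
  have hSline : ∀ s ∈ Set.Icc (0 : ℝ) 1, S (q + s • v) - s • x • T q = S q := by
    have := constant_of_has_deriv_right_zero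
      (f := fun s : ℝ => S (q + s • v) - s • x • T q) (a := 0) (b := 1) ?_ ?_
    · intro s hs
      simpa using this s hs
    · exact fun s hs => ((hder hS s hs).continuousAt.sub (by fun_prop)).continuousWithinAt
    · intro s hs
      have hs' : s ∈ Set.Icc (0 : ℝ) 1 := ⟨hs.1, hs.2.le⟩
      have h1 := (hder hS s hs').sub ((hasDerivAt_id s).smul_const (x • T q))
      have hTs : T (q + s • v) = T q := sub_eq_zero.1 (hconst s hs')
      have h2 : fderiv ℝ S (q + s • v) v = x • T q := by
        rw [hv, map_smul]
        have := hdS _ (hseg s hs')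
        rw [hTs] at this
        rw [← hv, this]
      rw [h2, one_smul, sub_self] at h1
      exact h1.hasDerivWithinAt
  have := hSline 1 (by simp)
  rw [one_smul, one_smul] at this
  rw [← this]; simp

end Calculus

/-! ### Minkowski algebra and the derivative identities. -/

section Mink

theorem mink_comm (u v : R31) : mink u v = mink v u := by simp only [mink]; ring

/-- The Minkowski product as a continuous bilinear map. -/
def minkL : R31 →L[ℝ] R31 →L[ℝ] ℝ :=
  (LinearMap.mk₂ ℝ mink
    (fun a b c => by simp only [mink, Pi.add_apply]; ring)
    (fun a b c => by simp only [mink, Pi.smul_apply, smul_eq_mul]; ring)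
    (fun a b c => by simp only [mink, Pi.add_apply]; ring)
    (fun a b c => by simp only [mink, Pi.smul_apply, smul_eq_mul]; ring)).toContinuousBilinearMap

theorem minkL_apply (u v : R31) : minkL u v = mink u v := rfl

theorem mink_add_left (u v w : R31) : mink (u + v) w = mink u w + mink v w := by
  simp [← minkL_apply]

theorem mink_sub_left (u v w : R31) : mink (u - v) w = mink u w - mink v w := by
  simp [← minkL_apply]

theorem mink_smul_left (c : ℝ) (u v : R31) : mink (c • u) v = c * mink u v := by
  simp [← minkL_apply]

theorem mink_add_right (u v w : R31) : mink u (v + w) = mink u v + mink u w := by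
  simp [← minkL_apply]

theorem mink_smul_right (c : ℝ) (u v : R31) : mink u (c • v) = c * mink u v := by
  simp [← minkL_apply]

theorem mink_zero_left (u : R31) : mink 0 u = 0 := by simp [← minkL_apply]

theorem contDiffOn_mink {E : Type*} [NormedAddCommGroup E] [NormedSpace ℝ E] {n : WithTop ℕ∞}
    {f g : E → R31} {U : Set E} (hf : ContDiffOn ℝ n f U) (hg : ContDiffOn ℝ n g U) :
    ContDiffOn ℝ n (fun x => mink (f x) (g x)) U :=
  (minkL.contDiff.comp_contDiffOn hf).clm_apply hg

theorem eq_zero_of_forall_mink_eq_zero {u : R31} (h : ∀ v, mink u v = 0) : u = 0 := by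
  ext i
  have := h (Pi.single i 1)
  fin_cases i <;> simpa [mink, Pi.single_apply] using this

theorem hasFDerivAt_mink {E : Type*} [NormedAddCommGroup E] [NormedSpace ℝ E] {f g : E → R31}
    {f' g' : E →L[ℝ] R31} {x : E} (hf : HasFDerivAt f f' x) (hg : HasFDerivAt g g' x) :
    ∃ h' : E →L[ℝ] ℝ, HasFDerivAt (fun x => mink (f x) (g x)) h' x ∧
      ∀ v, h' v = mink (f' v) (g x) + mink (f x) (g' v) :=
  ⟨_, minkL.hasFDerivAt_of_bilinear hf hg, fun v => by
    simp [ContinuousLinearMap.precompR_apply, ContinuousLinearMap.precompL_apply, minkL_apply]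
    ring⟩

theorem mink_fderiv_add_of_eqOn_zero {E : Type*} [NormedAddCommGroup E] [NormedSpace ℝ E]
    {f g : E → R31} {U : Set E} (hU : IsOpen U) {x : E} (hx : x ∈ U)
    (hf : DifferentiableAt ℝ f x) (hg : DifferentiableAt ℝ g x)
    (h0 : ∀ y ∈ U, mink (f y) (g y) = 0) (v : E) :
    mink (fderiv ℝ f x v) (g x) + mink (f x) (fderiv ℝ g x v) = 0 := by
  obtain ⟨h', hh, hv⟩ := hasFDerivAt_mink hf.hasFDerivAt hg.hasFDerivAt
  have h1 : HasFDerivAt (fun x => mink (f x) (g x)) (0 : E →L[ℝ] ℝ) x :=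
    (hasFDerivAt_const (0 : ℝ) x).congr_of_eventuallyEq (by
      filter_upwards [hU.mem_nhds hx] with y hy using h0 y hy)
  rw [← hv, hh.unique h1]; rfl

/-- The normal plane of a spacelike plane meets the orthogonal complement of a lightlike normal
vector in the line spanned by that vector. -/
theorem exists_eq_smul_of_mink_eq_zero (L : R2 →L[ℝ] R31)
    (hL : ∀ u, u ≠ 0 → 0 < mink (L u) (L u)) {N n : R31} (hN : IsLightlike N)
    (hNL : ∀ u, mink N (L u) = 0) (hnL : ∀ u, mink n (L u) = 0) (hnN : mink n N = 0) :
    ∃ c : ℝ, n = c • N := by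
  let A : (R2 × ℝ × ℝ) →ₗ[ℝ] R31 :=
    (L : R2 →ₗ[ℝ] R31).coprod ((LinearMap.toSpanSingleton ℝ R31 N).coprod
      (LinearMap.toSpanSingleton ℝ R31 n))
  have hA : ∀ u a b, A (u, a, b) = L u + (a • N + b • n) := fun u a b => by simp [A]
  -- Both sides have dimension 4, so injectivity would give surjectivity, and `N` would be
  -- orthogonal to all of `ℝ^{3,1}`.
  have hninj : ¬ Function.Injective A := by
    intro hinj
    have hs : Function.Surjective A :=
      (LinearMap.injective_iff_surjective_of_finrank_eq_finrank (by simp)).1 hinj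
    refine hN.1 (eq_zero_of_forall_mink_eq_zero fun v => ?_)
    obtain ⟨⟨u, a, b⟩, rfl⟩ := hs v
    rw [hA, mink_add_right, mink_add_right, mink_smul_right, mink_smul_right, hNL, hN.2,
      mink_comm N n, hnN]
    ring
  rw [injective_iff_map_eq_zero] at hninj
  push Not at hninj
  obtain ⟨⟨u, a, b⟩, h0, hne⟩ := hninj
  rw [hA] at h0
  have hu : u = 0 := by
    by_contra hu
    have h1 := hL u hu
    have h2 : mink (L u + (a • N + b • n)) (L u) = 0 := by rw [h0, mink_zero_left]
    rw [mink_add_left, mink_add_left, mink_smul_left, mink_smul_left, hNL, hnL] at h2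
    linarith
  subst hu
  rw [map_zero, zero_add] at h0
  have hb : b ≠ 0 := by
    rintro rfl
    rw [zero_smul, add_zero, smul_eq_zero] at h0
    rcases h0 with rfl | h0
    · exact hne rfl
    · exact hN.1 h0
  refine ⟨-(b⁻¹ * a), ?_⟩
  have h3 : n = b⁻¹ • (b • n) := by rw [smul_smul, inv_mul_cancel₀ hb, one_smul]
  rw [h3, eq_neg_of_add_eq_zero_right h0, smul_neg, smul_smul, neg_smul]

/-- The identity `⟨D_T T, dS w⟩ = 0` for the tangential part `T` of a constant vector with null
normal part, in local coordinates, together with `⟨D_T T, Z - T⟩ = 0`. -/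
theorem mink_fderiv_tangential {E : Type*} [NormedAddCommGroup E] [NormedSpace ℝ E]
    {S T : E → R31} {t : E → E} {U : Set E} (hU : IsOpen U) (hS : ContDiffOn ℝ ∞ S U)
    (hT : ContDiffOn ℝ ∞ T U) (ht : ContDiffOn ℝ ∞ t U) {Z : R31}
    (hSt : ∀ q ∈ U, fderiv ℝ S q (t q) = T q)
    (hnormal : ∀ q ∈ U, ∀ w, mink (Z - T q) (fderiv ℝ S q w) = 0)
    (hnull : ∀ q ∈ U, mink (Z - T q) (Z - T q) = 0) {q : E} (hq : q ∈ U) (w : E) :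
    mink (fderiv ℝ T q w) (Z - T q) = 0 ∧
      mink (fderiv ℝ T q (t q)) (fderiv ℝ S q w) = 0 := by
  have hUq := hU.mem_nhds hq
  have hTd : DifferentiableAt ℝ T q := (hT.contDiffAt hUq).differentiableAt (by simp)
  have htd : DifferentiableAt ℝ t q := (ht.contDiffAt hUq).differentiableAt (by simp)
  have hSd : DifferentiableAt ℝ (fderiv ℝ S) q :=
    ((hS.fderiv_of_isOpen hU (m := ∞) (by simp)).contDiffAt hUq).differentiableAt (by simp)
  have hNd : DifferentiableAt ℝ (fun x => Z - T x) q := hTd.const_sub Z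
  have hNf : ∀ v, fderiv ℝ (fun x => Z - T x) q v = -fderiv ℝ T q v := fun v => by
    rw [fderiv_const_sub]; rfl
  have hneg : ∀ u v : R31, mink (-u) v = -mink u v := fun u v => by simp [← minkL_apply]
  have h3 : ∀ v, mink (fderiv ℝ T q v) (Z - T q) = 0 := fun v => by
    have := mink_fderiv_add_of_eqOn_zero hU hq hNd hNd hnull v
    rw [hNf, mink_comm (Z - T q), hneg] at this
    linarith
  refine ⟨h3 w, ?_⟩
  -- This gives `⟨D_t T, dS w⟩ = ⟨N, D²S(t, w)⟩` with `N = Z - T`. By symmetry and `T = dS(t)`, the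
  -- right side is `⟨N, D_w T⟩ - ⟨N, dS(D_w t)⟩`, where both terms vanish.
  have h1 := mink_fderiv_add_of_eqOn_zero hU hq hNd (hSd.clm_apply (differentiableAt_const w))
    (fun y hy => hnormal y hy w) (t q)
  have hD1 : fderiv ℝ (fun x => fderiv ℝ S x w) q (t q) = fderiv ℝ (fderiv ℝ S) q (t q) w := by
    rw [fderiv_clm_apply hSd (differentiableAt_const w)]; simp
  have hsymm : fderiv ℝ (fderiv ℝ S) q (t q) w = fderiv ℝ (fderiv ℝ S) q w (t q) :=
    ((hS.contDiffAt hUq).isSymmSndFDerivAt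
      (by rw [minSmoothness_of_isRCLikeNormedField]; exact WithTop.coe_le_coe.2 (le_top : (2 : ℕ∞) ≤ ⊤))).eq _ _
  have hD2 : fderiv ℝ T q w
      = fderiv ℝ S q (fderiv ℝ t q w) + fderiv ℝ (fderiv ℝ S) q w (t q) := by
    have : T =ᶠ[nhds q] fun x => fderiv ℝ S x (t x) := by
      filter_upwards [hUq] with y hy using (hSt y hy).symm
    rw [this.fderiv_eq, fderiv_clm_apply hSd htd]; simp
  have h4 := h3 w
  rw [hD2, mink_add_left, mink_comm, hnormal q hq, mink_comm] at h4
  rw [hNf, hD1, hsymm, hneg] at h1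
  linarith

end Mink

/-! ### Parametrized surfaces over plane domains. -/

section Local

/-- The tangential part of a constant vector along a parametrized spacelike surface is smooth. -/
theorem contDiffOn_tangential {S T : ℝ × ℝ → R31} {U : Set (ℝ × ℝ)} (hU : IsOpen U)
    (hS : ContDiffOn ℝ ∞ S U) {Z : R31}
    (hpos : ∀ q ∈ U, ∀ w, w ≠ 0 → 0 < mink (fderiv ℝ S q w) (fderiv ℝ S q w))
    (htan : ∀ q ∈ U, ∃ v, fderiv ℝ S q v = T q)
    (hnormal : ∀ q ∈ U, ∀ w, mink (Z - T q) (fderiv ℝ S q w) = 0) :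
    ContDiffOn ℝ ∞ T U := by
  have hD : ContDiffOn ℝ ∞ (fderiv ℝ S) U := hS.fderiv_of_isOpen hU (by simp)
  let A : ℝ × ℝ → R31 := fun q => fderiv ℝ S q (1, 0)
  let B : ℝ × ℝ → R31 := fun q => fderiv ℝ S q (0, 1)
  have hA : ContDiffOn ℝ ∞ A U := hD.clm_apply contDiffOn_const
  have hB : ContDiffOn ℝ ∞ B U := hD.clm_apply contDiffOn_const
  have hZ : ContDiffOn ℝ ∞ (fun _ : ℝ × ℝ => Z) U := contDiffOn_const
  -- `D` is the Gram determinant of the coordinate frame.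
  let D : ℝ × ℝ → ℝ := fun q => mink (A q) (A q) * mink (B q) (B q) - mink (A q) (B q) * mink (A q) (B q)
  have hlin : ∀ q v, fderiv ℝ S q v = v.1 • A q + v.2 • B q := fun q v => by
    rw [← map_smul, ← map_smul, ← map_add]; simp
  have hDne : ∀ q ∈ U, D q ≠ 0 := by
    intro q hq h0
    have hE : 0 < mink (A q) (A q) := hpos q hq (1, 0) (by simp)
    -- This vector is orthogonal to `A q`, and its square is `mink (A q) (A q) * D q`.
    have h1 := hpos q hq (-mink (A q) (B q), mink (A q) (A q)) (by
      intro h; exact hE.ne' (congrArg Prod.snd h))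
    rw [hlin] at h1
    simp only [mink_add_left, mink_add_right, mink_smul_left, mink_smul_right,
      mink_comm (B q) (A q)] at h1
    have h2 : mink (A q) (A q) * D q = 0 := by rw [h0, mul_zero]
    simp only [D] at h2
    nlinarith
  have hDs : ContDiffOn ℝ ∞ D U :=
    ((contDiffOn_mink hA hA).mul (contDiffOn_mink hB hB)).sub
      ((contDiffOn_mink hA hB).mul (contDiffOn_mink hA hB))
  -- Cramer's rule for the coordinates of the tangential part: smoothness of `T` follows from a
  -- formula in the first derivatives of `S`.
  have hform : ∀ q ∈ U, T q =
      ((mink Z (A q) * mink (B q) (B q) - mink Z (B q) * mink (A q) (B q)) / D q) • A q +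
      ((mink Z (B q) * mink (A q) (A q) - mink Z (A q) * mink (A q) (B q)) / D q) • B q := by
    intro q hq
    obtain ⟨v, hv⟩ := htan q hq
    have hne := hDne q hq
    have h1 := hnormal q hq (1, 0)
    have h2 := hnormal q hq (0, 1)
    change mink (Z - T q) (A q) = 0 at h1
    change mink (Z - T q) (B q) = 0 at h2
    rw [hlin] at hv
    rw [mink_sub_left, ← hv, mink_add_left, mink_smul_left, mink_smul_left,
      mink_comm (B q) (A q)] at h1
    rw [mink_sub_left, ← hv, mink_add_left, mink_smul_left, mink_smul_left] at h2
    have e1 : v.1 =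
        (mink Z (A q) * mink (B q) (B q) - mink Z (B q) * mink (A q) (B q)) / D q := by
      rw [eq_div_iff hne]; simp only [D]; linear_combination -(mink (B q) (B q)) * h1 + mink (A q) (B q) * h2
    have e2 : v.2 =
        (mink Z (B q) * mink (A q) (A q) - mink Z (A q) * mink (A q) (B q)) / D q := by
      rw [eq_div_iff hne]; simp only [D]; linear_combination -(mink (A q) (A q)) * h2 + mink (A q) (B q) * h1
    rw [← e1, ← e2, hv]
  refine ContDiffOn.congr ?_ hform
  exact ((((contDiffOn_mink hZ hA).mul (contDiffOn_mink hB hB)).sub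
      ((contDiffOn_mink hZ hB).mul (contDiffOn_mink hA hB))).div hDs hDne).smul hA |>.add
    (((((contDiffOn_mink hZ hB).mul (contDiffOn_mink hA hA)).sub
      ((contDiffOn_mink hZ hA).mul (contDiffOn_mink hA hB))).div hDs hDne).smul hB)

/-- A parametrized surface which is a graph over its parameter domain, with a nowhere vanishing
tangent field that is constant along itself, admits a local ruled reparametrization. -/
theorem exists_ruled_reparametrization {V : Type*} [NormedAddCommGroup V] [NormedSpace ℝ V]
    {S T : ℝ × ℝ → V} {U : Set (ℝ × ℝ)} (hU : IsOpen U)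
    (hS : ContDiffOn ℝ ∞ S U) (hT : ContDiffOn ℝ ∞ T U) (P : V →L[ℝ] ℝ × ℝ)
    (hdS : ∀ q ∈ U, fderiv ℝ S q (P (T q)) = T q)
    (hdT : ∀ q ∈ U, fderiv ℝ T q (P (T q)) = 0) {q : ℝ × ℝ} (hq : q ∈ U) (hne : P (T q) ≠ 0) :
    ∃ ε > 0, ∃ κ : OpenPartialHomeomorph (ℝ × ℝ) (ℝ × ℝ),
      κ.source = Set.Ioo (-ε) ε ×ˢ Set.Ioo (-ε) ε ∧ κ (0, 0) = q ∧ κ.target ⊆ U ∧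
      ContDiffOn ℝ ∞ κ κ.source ∧ ContDiffOn ℝ ∞ κ.symm κ.target ∧
      ∀ x y, (x, y) ∈ κ.source → S (κ (x, y)) = S (κ (0, y)) + x • T (κ (0, y)) := by
  obtain ⟨a, b, hab⟩ : ∃ a b, P (T q) = (a, b) := ⟨_, _, rfl⟩
  -- A quarter turn of `P (T q)`: the line `ℓ` through `q` is transversal to the field, and `k`
  -- leaves it along the field.
  let w : ℝ × ℝ := (-b, a)
  let ℓ : ℝ × ℝ → ℝ × ℝ := fun z => q + z.2 • w
  let k : ℝ × ℝ → ℝ × ℝ := fun z => ℓ z + z.1 • P (T (ℓ z))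
  have hℓ : ContDiff ℝ ∞ ℓ := contDiff_const.add (contDiff_snd.smul contDiff_const)
  have hO1 : IsOpen (ℓ ⁻¹' U) := hU.preimage hℓ.continuous
  have hTℓ : ContDiffOn ℝ ∞ (fun z => P (T (ℓ z))) (ℓ ⁻¹' U) :=
    P.contDiff.comp_contDiffOn (hT.comp hℓ.contDiffOn fun z hz => hz)
  have hk : ContDiffOn ℝ ∞ k (ℓ ⁻¹' U) :=
    hℓ.contDiffOn.add (contDiff_fst.contDiffOn.smul hTℓ)
  have hO : IsOpen (ℓ ⁻¹' U ∩ k ⁻¹' U) := hk.continuousOn.isOpen_inter_preimage hO1 hU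
  have hℓ0 : ℓ (0, 0) = q := by simp [ℓ]
  have hk0 : k (0, 0) = q := by simp [k, hℓ0]
  have h0 : ((0, 0) : ℝ × ℝ) ∈ ℓ ⁻¹' U ∩ k ⁻¹' U := by
    constructor
    · rw [Set.mem_preimage, hℓ0]; exact hq
    · rw [Set.mem_preimage, hk0]; exact hq
  let A : ℝ × ℝ →L[ℝ] ℝ × ℝ := (ContinuousLinearMap.snd ℝ ℝ ℝ).smulRight w +
    (ContinuousLinearMap.fst ℝ ℝ ℝ).smulRight (P (T q))
  have hAinj : Function.Injective (A : ℝ × ℝ →ₗ[ℝ] ℝ × ℝ) := by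
    rw [injective_iff_map_eq_zero]
    rintro ⟨x, y⟩ hxy
    have hxy' : y • w + x • P (T q) = 0 := hxy
    rw [hab] at hxy' hne
    have h1 : y * -b + x * a = 0 := congrArg Prod.fst hxy'
    have h2 : y * a + x * b = 0 := congrArg Prod.snd hxy'
    have hpos : a ^ 2 + b ^ 2 ≠ 0 := by
      intro h
      apply hne
      have ha : a = 0 := by nlinarith [sq_nonneg a, sq_nonneg b]
      have hb : b = 0 := by nlinarith [sq_nonneg a, sq_nonneg b]
      rw [ha, hb]; rfl
    have hx : x * (a ^ 2 + b ^ 2) = 0 := by linear_combination a * h1 + b * h2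
    have hy : y * (a ^ 2 + b ^ 2) = 0 := by linear_combination -b * h1 + a * h2
    rw [(mul_eq_zero.1 hx).resolve_right hpos, (mul_eq_zero.1 hy).resolve_right hpos]; rfl
  let A' : (ℝ × ℝ) ≃L[ℝ] ℝ × ℝ :=
    (LinearEquiv.ofInjectiveEndo (A : ℝ × ℝ →ₗ[ℝ] ℝ × ℝ) hAinj).toContinuousLinearEquiv
  have hA' : (A' : ℝ × ℝ →L[ℝ] ℝ × ℝ) = A := by ext <;> rfl
  have hder : HasFDerivAt k (A' : ℝ × ℝ →L[ℝ] ℝ × ℝ) (0, 0) := by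
    rw [hA']
    have h1 : HasFDerivAt ℓ ((ContinuousLinearMap.snd ℝ ℝ ℝ).smulRight w) (0, 0) :=
      ((ContinuousLinearMap.snd ℝ ℝ ℝ).hasFDerivAt.smul_const w).const_add q
    have h2 := ((hTℓ.contDiffAt (hO1.mem_nhds h0.1)).differentiableAt (by simp)).hasFDerivAt
    have h3 := h1.add ((ContinuousLinearMap.fst ℝ ℝ ℝ).hasFDerivAt.smul h2)
    convert! h3 using 1
    simp [A, hℓ0]
  obtain ⟨e, h0e, heO, hek, hesymm⟩ := exists_openPartialHomeomorph_of_hasFDerivAt hO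
    (hk.mono Set.inter_subset_left) h0 hder
  obtain ⟨ε, hε, hball⟩ := Metric.isOpen_iff.1 e.open_source _ h0e
  have hsq : Metric.ball ((0, 0) : ℝ × ℝ) ε = Set.Ioo (-ε) ε ×ˢ Set.Ioo (-ε) ε := by
    rw [← ball_prod_same, Real.ball_eq_Ioo]; simp
  rw [hsq] at hball
  have hsource : (e.restr (Set.Ioo (-ε) ε ×ˢ Set.Ioo (-ε) ε)).source
      = Set.Ioo (-ε) ε ×ˢ Set.Ioo (-ε) ε := by
    rw [e.restr_source' _ (isOpen_Ioo.prod isOpen_Ioo)]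
    exact Set.inter_eq_right.2 hball
  have hmem : ∀ z ∈ Set.Ioo (-ε) ε ×ˢ Set.Ioo (-ε) ε, ℓ z ∈ U ∧ k z ∈ U := fun z hz =>
    heO (hball hz)
  have hcoe : ∀ z, e.restr (Set.Ioo (-ε) ε ×ˢ Set.Ioo (-ε) ε) z = k z := hek
  refine ⟨ε, hε, e.restr (Set.Ioo (-ε) ε ×ˢ Set.Ioo (-ε) ε), hsource, ?_, ?_, ?_, ?_, ?_⟩
  · rw [hcoe, hk0]
  · intro z hz
    have h1 := (e.restr (Set.Ioo (-ε) ε ×ˢ Set.Ioo (-ε) ε)).map_target hz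
    rw [hsource] at h1
    have h2 := (hmem _ h1).2
    rwa [← hcoe, (e.restr _).right_inv hz] at h2
  · rw [hsource]
    exact (hk.mono fun z hz => (hmem z hz).1).congr fun z _ => hcoe z
  · exact hesymm.mono fun z hz => hz.1
  · intro x y hxy
    rw [hsource] at hxy
    have hℓxy : ℓ (x, y) = ℓ (0, y) := rfl
    have hk0y : k (0, y) = ℓ (0, y) := by simp [k]
    rw [hcoe, hcoe, hk0y]
    change S (ℓ (0, y) + x • P (T (ℓ (0, y)))) = _
    refine eq_add_smul_of_fderiv_self_eq_zero hU hS hT P hdS hdT fun s hs => ?_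
    -- The square is stable under shrinking `x`, so the whole segment is the image under `k` of
    -- points of the square.
    have hsx : (s * x, y) ∈ Set.Ioo (-ε) ε ×ˢ Set.Ioo (-ε) ε := by
      refine ⟨abs_lt.1 ?_, hxy.2⟩
      have hx : |x| < ε := abs_lt.2 hxy.1
      rw [abs_mul, abs_of_nonneg hs.1]
      exact (mul_le_of_le_one_left (abs_nonneg x) hs.2).trans_lt hx
    have := (hmem _ hsx).2
    rw [smul_smul]
    exact this

end Local

/-! ### Charts and second fundamental form of the immersed surface. -/

section Surface

variable {M : Type*} [TopologicalSpace M] [ChartedSpace R2 M]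

/-- Near each point of a spacelike surface, a suitable linear projection of `ℝ^{3,1}` onto a plane
restricts to a chart. -/
theorem exists_projection_chart [IsManifold (𝓡 2) ∞ M] {F : M → R31} (hF : IsSpacelikeSurface F) (p : M) :
    ∃ (P : R31 →L[ℝ] ℝ × ℝ) (e : OpenPartialHomeomorph M (ℝ × ℝ)), p ∈ e.source ∧
      (∀ q ∈ e.source, e q = P (F q)) ∧
      ContMDiffOn (𝓡 2) 𝓘(ℝ, ℝ × ℝ) ∞ e e.source ∧
      ContMDiffOn 𝓘(ℝ, ℝ × ℝ) (𝓡 2) ∞ e.symm e.target := by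
  let φ := chartAt R2 p
  let L : R2 →L[ℝ] R31 := dF F p
  have hpos : ∀ u : R2, u ≠ 0 → 0 < mink (L u) (L u) := hF.pos p
  let u₀ : R2 := EuclideanSpace.single 0 1
  let u₁ : R2 := EuclideanSpace.single 1 1
  -- Pairing with a basis of the tangent plane: `P ∘L L` is the Gram matrix of that basis,
  -- invertible by positivity.
  let P : R31 →L[ℝ] ℝ × ℝ := (minkL (L u₀)).prod (minkL (L u₁))
  have hPinj : Function.Injective (P ∘L L : R2 →ₗ[ℝ] ℝ × ℝ) := by
    rw [injective_iff_map_eq_zero]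
    intro u hu
    by_contra hne
    have h := hpos u hne
    have h0 : mink (L u₀) (L u) = 0 := congrArg Prod.fst hu
    have h1 : mink (L u₁) (L u) = 0 := congrArg Prod.snd hu
    have hdec : u = u 0 • u₀ + u 1 • u₁ := by
      ext i; fin_cases i <;> simp [u₀, u₁]
    have : mink (L u) (L u) = 0 := by
      conv_lhs => arg 1; rw [hdec]
      rw [map_add, map_smul, map_smul, mink_add_left, mink_smul_left, mink_smul_left, h0, h1]
      ring
    exact h.ne' this
  let A : R2 ≃L[ℝ] ℝ × ℝ :=
    (LinearEquiv.ofInjectiveOfFinrankEq (P ∘L L : R2 →ₗ[ℝ] ℝ × ℝ) hPinj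
      (by simp)).toContinuousLinearEquiv
  have hA : (A : R2 →L[ℝ] ℝ × ℝ) = P ∘L L := by ext <;> rfl
  have hsm : ContDiffOn ℝ ∞ (F ∘ φ.symm) φ.target :=
    contMDiffOn_iff_contDiffOn.1
      (hF.smooth.comp_contMDiffOn (contMDiffOn_chart_symm (I := 𝓡 2) (n := ∞) (x := p)))
  have hder : HasFDerivAt (F ∘ φ.symm) L (φ p) := by
    have h := (hF.smooth.contMDiffAt (x := p)).mdifferentiableAt (by simp) |>.hasMFDerivAt.2
    simp only [modelWithCornersSelf_coe, Set.range_id] at h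
    exact HasFDerivWithinAt.hasFDerivAt_of_univ h
  have hderP : HasFDerivAt (fun x => P ((F ∘ φ.symm) x)) (A : R2 →L[ℝ] ℝ × ℝ) (φ p) := by
    rw [hA]; exact P.hasFDerivAt.comp _ hder
  obtain ⟨e, he, hesub, hef, hesymm⟩ := exists_openPartialHomeomorph_of_hasFDerivAt φ.open_target
    (P.contDiff.comp_contDiffOn hsm) (φ.map_source (mem_chart_source R2 p)) hderP
  have heq : ∀ q ∈ (φ.trans e).source, (φ.trans e) q = P (F q) := by
    intro q hq
    rw [φ.trans_source] at hq
    change e (φ q) = _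
    rw [hef]
    change P (F (φ.symm (φ q))) = _
    rw [φ.left_inv hq.1]
  refine ⟨P, φ.trans e, ?_, heq, ?_, ?_⟩
  · rw [φ.trans_source]; exact ⟨mem_chart_source R2 p, he⟩
  · exact ((P.contDiff.contMDiff.comp hF.smooth).contMDiffOn).congr heq
  · refine (contMDiffOn_chart_symm (I := 𝓡 2) (n := ∞) (x := p)).comp
      (hesymm.contMDiffOn.mono fun z hz => ?_) fun z hz => ?_
    · rw [φ.trans_target] at hz; exact hz.1
    · rw [φ.trans_target] at hz; exact hz.2

/-- On a spacelike surface with a canonical normal null direction, the number `β(v)` does satisfy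
`B(v, Z^⊤) = β(v) Z^⊥` as soon as `B(v, Z^⊤)` is orthogonal to `Z^⊥`. -/
theorem secondFF_Ztop_eq_betaForm_smul {F : M → R31} (hF : IsSpacelikeSurface F) {Z : R31}
    (hnull : IsCanonicalNormalNullDirection F Z) {p : M} {v : TangentSpace (𝓡 2) p}
    (h : mink (secondFF F p v (Ztop F Z)) (Zperp F Z p) = 0) :
    secondFF F p v (Ztop F Z) = betaForm F Z p v • Zperp F Z p := by
  have hex : ∃ c : ℝ, secondFF F p v (Ztop F Z) = c • Zperp F Z p :=
    exists_eq_smul_of_mink_eq_zero (dF F p) (hF.pos p) (hnull p) (mink_normalPart hF p Z)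
      (mink_normalPart hF p _) h
  unfold betaForm
  rw [dif_pos hex]
  exact hex.choose_spec

/-- A vector orthogonal to the tangent plane has no tangential part. -/
theorem tangentialPart_eq_zero {F : M → R31} (hF : IsSpacelikeSurface F) {p : M} {z : R31}
    (h : ∀ w : TangentSpace (𝓡 2) p, mink z (dF F p w) = 0) : tangentialPart F p z = 0 := by
  by_contra hne
  have h1 := hF.pos p _ hne
  have h2 := mink_normalPart hF p z (tangentialPart F p z)
  rw [normalPart, mink_sub_left, h] at h2
  linarith

end Surface

/-- Along a spacelike surface with canonical normal null direction `Z`, the condition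
`β(Z^⊤) = 0` makes `Z^⊤` constant along itself as a map to `ℝ^{3,1}`, and the surface is ruled by
`Z^⊤`. -/
theorem exists_ruledParametrization {M : Type*} [TopologicalSpace M] [ChartedSpace R2 M]
    [IsManifold (𝓡 2) ∞ M] {F : M → R31} (hF : IsSpacelikeSurface F) {Z : R31}
    (hZ : mink Z Z = 1) (hnull : IsCanonicalNormalNullDirection F Z)
    (hβ : ∀ p : M, betaForm F Z p (Ztop F Z p) = 0) (p : M) :
    ∃ ε > 0, ∃ Φ : OpenPartialHomeomorph (ℝ × ℝ) M, Φ (0, 0) = p ∧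
      IsRuledParametrization F ε Φ (fun y => F (Φ (0, y)))
        (fun y => dF F (Φ (0, y)) (Ztop F Z (Φ (0, y)))) := by
  obtain ⟨P, e, hpe, heP, hes, hesymm⟩ := exists_projection_chart hF p
  let T' : M → R31 := fun q => dF F q (Ztop F Z q)
  let S : ℝ × ℝ → R31 := fun q => F (e.symm q)
  let T : ℝ × ℝ → R31 := fun q => T' (e.symm q)
  have hU := e.open_target
  have hed : e.MDifferentiable (𝓡 2) 𝓘(ℝ, ℝ × ℝ) :=
    ⟨hes.mdifferentiableOn (by simp), hesymm.mdifferentiableOn (by simp)⟩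
  have hchain : ∀ (f : M → R31) (q : ℝ × ℝ), q ∈ e.target →
      MDifferentiableAt (𝓡 2) 𝓘(ℝ, R31) f (e.symm q) → ∀ v : ℝ × ℝ,
      fderiv ℝ (fun x => f (e.symm x)) q v
        = mfderiv (𝓡 2) 𝓘(ℝ, R31) f (e.symm q) (mfderiv 𝓘(ℝ, ℝ × ℝ) (𝓡 2) e.symm q v) := by
    intro f q hq hf v
    have h := mfderiv_comp q hf (hed.mdifferentiableAt_symm hq)
    rw [mfderiv_eq_fderiv] at h
    exact congrArg (fun A : ℝ × ℝ →L[ℝ] R31 => A v) h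
  have hbij : ∀ q ∈ e.target,
      Function.Bijective (mfderiv 𝓘(ℝ, ℝ × ℝ) (𝓡 2) e.symm q) := fun q hq =>
    hed.symm.mfderiv_bijective hq
  have hSd : ∀ q ∈ e.target, ∀ v : ℝ × ℝ,
      fderiv ℝ S q v = dF F (e.symm q) (mfderiv 𝓘(ℝ, ℝ × ℝ) (𝓡 2) e.symm q v) := fun q hq v =>
    hchain F q hq ((hF.smooth _).mdifferentiableAt (by simp)) v
  have hS : ContDiffOn ℝ ∞ S e.target :=
    contMDiffOn_iff_contDiffOn.1 (hF.smooth.comp_contMDiffOn hesymm)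
  have hpre : ∀ q ∈ e.target, ∃ v : ℝ × ℝ,
      mfderiv 𝓘(ℝ, ℝ × ℝ) (𝓡 2) e.symm q v = Ztop F Z (e.symm q) := fun q hq =>
    (hbij q hq).2 _
  -- The chart is `P ∘ F`, so `P ∘ S` is the identity and `P` is a left inverse of `dS`. Hence `P (T
  -- q)` is the coordinate expression of `Z^⊤`.
  have hPS : ∀ q ∈ e.target, ∀ v, P (fderiv ℝ S q v) = v := by
    intro q hq v
    have h1 : HasFDerivAt (fun x => P (S x)) (P ∘L fderiv ℝ S q) q :=
      P.hasFDerivAt.comp q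
        ((hS.contDiffAt (hU.mem_nhds hq)).differentiableAt (by simp)).hasFDerivAt
    have h2 : HasFDerivAt (fun x => P (S x)) (ContinuousLinearMap.id ℝ (ℝ × ℝ)) q := by
      refine (hasFDerivAt_id q).congr_of_eventuallyEq ?_
      filter_upwards [hU.mem_nhds hq] with x hx
      rw [← heP _ (e.map_target hx), e.right_inv hx]; rfl
    exact congrArg (fun A : ℝ × ℝ →L[ℝ] ℝ × ℝ => A v) (h1.unique h2)
  have hPT : ∀ q ∈ e.target,
      mfderiv 𝓘(ℝ, ℝ × ℝ) (𝓡 2) e.symm q (P (T q)) = Ztop F Z (e.symm q) := by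
    intro q hq
    obtain ⟨v, hv⟩ := hpre q hq
    have h : P (T q) = v := by
      rw [← hPS q hq v, hSd q hq v, hv]
    rw [h, hv]
  have hdS : ∀ q ∈ e.target, fderiv ℝ S q (P (T q)) = T q := fun q hq => by
    rw [hSd q hq, hPT q hq]
  have hpos : ∀ q ∈ e.target, ∀ w, w ≠ 0 → 0 < mink (fderiv ℝ S q w) (fderiv ℝ S q w) := by
    intro q hq w hw
    rw [hSd q hq]
    refine hF.pos _ _ fun h => hw ((hbij q hq).1 ?_)
    exact h.trans (map_zero _).symm
  have hnormal : ∀ q ∈ e.target, ∀ w, mink (Z - T q) (fderiv ℝ S q w) = 0 := fun q hq w => by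
    rw [hSd q hq]; exact mink_normalPart hF (e.symm q) Z _
  have hnullT : ∀ q ∈ e.target, mink (Z - T q) (Z - T q) = 0 := fun q _ =>
    (hnull (e.symm q)).2
  have hT : ContDiffOn ℝ ∞ T e.target :=
    contDiffOn_tangential hU hS hpos (fun q hq => ⟨_, hdS q hq⟩) hnormal
  have hT'd : ∀ q ∈ e.target, MDifferentiableAt (𝓡 2) 𝓘(ℝ, R31) T' (e.symm q) := by
    intro q hq
    have hm := e.map_target hq
    have h1 : ContMDiffOn (𝓡 2) 𝓘(ℝ, R31) ∞ (fun x => T (e x)) e.source :=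
      hT.contMDiffOn.comp hes fun x hx => e.map_source hx
    have h2 : ContMDiffOn (𝓡 2) 𝓘(ℝ, R31) ∞ T' e.source := h1.congr fun x hx => by
      change _ = T' (e.symm (e x)); rw [e.left_inv hx]
    exact (h2.contMDiffAt (e.open_source.mem_nhds hm)).mdifferentiableAt (by simp)
  have hdT : ∀ q ∈ e.target, fderiv ℝ T q (P (T q)) = 0 := by
    intro q hq
    have hamb : fderiv ℝ T q (P (T q))
        = ambientDeriv F (e.symm q) (Ztop F Z (e.symm q)) (Ztop F Z) := by
      rw [hchain T' q hq (hT'd q hq), hPT q hq]; rfl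
    have hmink := mink_fderiv_tangential hU hS hT (P.contDiff.comp_contDiffOn hT) hdS hnormal
      hnullT hq
    have hlc : leviCivita F (e.symm q) (Ztop F Z (e.symm q)) (Ztop F Z) = 0 := by
      refine tangentialPart_eq_zero hF fun w => ?_
      obtain ⟨v, rfl⟩ := (hbij q hq).2 w
      rw [← hamb]
      exact (congrArg (mink _) (hSd q hq v)).symm.trans (hmink v).2
    have hB : secondFF F (e.symm q) (Ztop F Z (e.symm q)) (Ztop F Z)
        = fderiv ℝ T q (P (T q)) := by
      rw [secondFF, hlc, map_zero, sub_zero, hamb]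
    -- The remaining side goal, orthogonality to `Z^⊥`, ensures that `betaForm` is the actual
    -- coefficient here and not its default value 0.
    rw [← hB, secondFF_Ztop_eq_betaForm_smul hF hnull, hβ, zero_smul]
    rw [hB]
    exact (hmink _).1
  have hpt : e p ∈ e.target := e.map_source hpe
  -- If `T` vanished, `Z` would equal its null normal part, against `⟨Z, Z⟩ = 1`.
  have hne : P (T (e p)) ≠ 0 := by
    intro h0
    have hT0 : T (e p) = 0 := by rw [← hdS _ hpt, h0, map_zero]
    have := hnullT _ hpt
    rw [hT0, sub_zero, hZ] at this
    exact one_ne_zero this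
  obtain ⟨ε, hε, κ, hsource, hκ0, hκU, hκ, hκsymm, hruled⟩ :=
    exists_ruled_reparametrization hU hS hT P hdS hdT hpt hne
  have hΦsource : (κ.trans e.symm).source = Set.Ioo (-ε) ε ×ˢ Set.Ioo (-ε) ε := by
    rw [κ.trans_source, ← hsource]
    exact Set.inter_eq_left.2 fun z hz => hκU (κ.map_source hz)
  have hmap : Set.MapsTo κ κ.source e.target := fun z hz => hκU (κ.map_source hz)
  have haxis : ∀ y ∈ Set.Ioo (-ε) ε, ((0 : ℝ), y) ∈ κ.source := fun y hy => by
    rw [hsource]; exact ⟨by simpa using hε, hy⟩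
  have hκaxis : ContDiffOn ℝ ∞ (fun y : ℝ => κ (0, y)) (Set.Ioo (-ε) ε) :=
    hκ.comp (contDiff_const.prodMk contDiff_id).contDiffOn haxis
  refine ⟨ε, hε, κ.trans e.symm, ?_, hΦsource, ?_, ?_, ?_, ?_, ?_⟩
  · change e.symm (κ (0, 0)) = p
    rw [hκ0, e.left_inv hpe]
  · rw [hΦsource, ← hsource]
    exact hesymm.comp hκ.contMDiffOn hmap
  · refine hκsymm.contMDiffOn.comp (hes.mono fun z hz => ?_) fun z hz => ?_
    · rw [κ.trans_target] at hz; exact hz.1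
    · rw [κ.trans_target] at hz; exact hz.2
  · exact hS.comp hκaxis fun y hy => hmap (haxis y hy)
  · exact hT.comp hκaxis fun y hy => hmap (haxis y hy)
  · intro x hx y hy
    exact hruled x y (by rw [hsource]; exact ⟨hx, hy⟩)

end MinkowskiSurface

end

theorem theorem1p16 {M : Type*} [TopologicalSpace M] [ChartedSpace MinkowskiSurface.R2 M]
    [IsManifold (𝓡 2) ∞ M]
    (F : M → MinkowskiSurface.R31) (hF : MinkowskiSurface.IsSpacelikeSurface F)
    (Z : MinkowskiSurface.R31) (hZ : MinkowskiSurface.mink Z Z = 1)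
    (hnull : MinkowskiSurface.IsCanonicalNormalNullDirection F Z)
    (W : (q : M) → TangentSpace (𝓡 2) q)
    (hW : MinkowskiSurface.IsUnitOrthogonalField F Z W)
    (ha : ∀ p : M, MinkowskiSurface.aFun F Z W p = 0)
    (hβ : ∀ p : M, MinkowskiSurface.betaForm F Z p (MinkowskiSurface.Ztop F Z p) = 0) :
    MinkowskiSurface.IsRuled F ∧
    ∀ p : M, ∃ ε > 0, ∃ (Φ : OpenPartialHomeomorph (ℝ × ℝ) M) (c : ℝ → M),
      c 0 = p ∧ (∀ y ∈ Set.Ioo (-ε) ε, Φ (0, y) = c y) ∧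
      MinkowskiSurface.IsRuledParametrization F ε Φ
        (fun y => F (c y))
        (fun y => MinkowskiSurface.dF F (c y) (MinkowskiSurface.Ztop F Z (c y))) := by
  have key := MinkowskiSurface.exists_ruledParametrization hF hZ hnull hβ
  refine ⟨fun p => ?_, fun p => ?_⟩
  · obtain ⟨ε, hε, Φ, h0, hΦ⟩ := key p
    refine ⟨ε, hε, Φ, _, _, ?_, hΦ⟩
    rw [← h0]
    refine Φ.map_source ?_
    rw [hΦ.source_eq]
    simpa using hε
  · obtain ⟨ε, hε, Φ, h0, hΦ⟩ := key p
    exact ⟨ε, hε, Φ, fun y => Φ (0, y), h0, fun _ _ => rfl, hΦ⟩
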